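/- Let $d,T,\Delta$ be natural numbers, $\epsilon>0$ and $\delta\in[0,1]$. **Streams and privacy.** An input is a stream $x=x^1,\dots,x^T$ with $x^t\in\{0,1\}^d$. Two streams are neighboring if they differ in at most one time step. A randomized algorithm $\mathcal A$ that produces an output at every time step is $(\epsilon,\delta)$-differentially private if $\Pr[\mathcal A(x)\in S]\le e^{\epsilon}\Pr[\mathcal A(y)\in S]+\delta$ for all neighboring $x,y$ and all measurable sets $S$ of sequences of outputs. **Adaptive privacy.** Let $H$ be a randomized mechanism that receives a vector in $\mathbb N^d$ at every time step and answers with a vector in $\mathbb R^d$ that depends only on its random coins and on the inputs received so far. In the privacy game over $n$ time steps with $\mathrm{side}\in\{L,R\}$, a randomized adversary, knowing its own coins and the previous answers of $H$, chooses at every time step either one vector $u\in\mathbb N^d$ (regular step), which is sent to $H$, or a pair $(u^{(L)},u^{(R)})$ of vectors in $\mathbb N^d$ with $\|u^{(L)}-u^{(R)}\|_\infty\le 1$ (challenge step), of which $u^{(\mathrm{side})}$ is sent to $H$; it makes exactly one challenge. Its view $V^{(\mathrm{side})}$ consists of its coins, its choices and the answers of $H$. The mechanism $H$ is adaptively $(\epsilon',\delta')$-differentially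 private for stream length $n$ if for every adversary and every measurable set $S$ of views, $\Pr[V^{(L)}\in S]\le e^{\epsilon'}\Pr[V^{(R)}\in S]+\delta'$ and $\Pr[V^{(R)}\in S]\le e^{\epsilon'}\Pr[V^{(L)}\in S]+\delta'$. **Meta mechanism.** Its parameters are $\Delta$, an initial vector $s\in\mathbb R^d$, thresholds $K_1,\dots,K_\Delta\in\mathbb R$, a measurable function $g:\mathbb R^d\to\mathbb R$ with $|g(y)-g(y')|\le1$ whenever $\|y-y'\|_\infty\le1$, and the mechanism $H$. Draw independent noises $\tau_j\sim\mathrm{Lap}(4/\epsilon)$ for $1\le j\le\Delta$ and $\mu_t\sim\mathrm{Lap}(8/\epsilon)$ for $1\le t\le T$, independent of the coins of $H$. Start with $j=1$ and $c=0\in\mathbb N^d$. At each time $t=1,\dots,T$: add $x^t$ to $c$ and to $s$; if $j\le\Delta$ and $g(s)+\mu_t>K_j+\tau_j$, then close the current interval: increase $j$ by $1$, insert $c$ into $H$, reset $c$ to $0$, set $s$ to the answer of $H$, and output $s$. Otherwise nothing is output at time $t$. (So the outputs show the times at which intervals are closed, and the histogram obtained from $H$ at each of these times.) **Claim.** If $H$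 is adaptively $(\epsilon/2,\ \delta/e^{\epsilon/2})$-differentially private for stream length $\Delta$, then the meta mechanism is $(\epsilon,\delta)$-differentially private. -/

import Mathlib

open MeasureTheory

universe u v

noncomputable section

namespace ContinualDP

/-! ## Differential privacy -/

/-- Every event of probability `p` under `μ` and `q` under `ν` satisfies `p ≤ e ^ ε * q + δ`. -/
def DPClose {α : Type u} [MeasurableSpace α] {Ω : Type v} [MeasurableSpace Ω]
    (P : Measure Ω) (X Y : Ω → α) (ε δ : ℝ) : Prop :=
  ∀ S : Set α, MeasurableSet S →
    P {ω | X ω ∈ S} ≤ ENNReal.ofReal (Real.exp ε) * P {ω | Y ω ∈ S} + ENNReal.ofReal δ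

/-- A stream `x¹, …, x^T` of elements of `{0,1}^d`. -/
abbrev BinStream (d T : ℕ) : Type := Fin T → Fin d → Fin 2

/-- Two streams are neighboring if they differ in at most one time step. -/
def Neighboring {d T : ℕ} (x y : BinStream d T) : Prop :=
  {t : Fin T | x t ≠ y t}.Subsingleton

/-- `(ε, δ)`-differential privacy of a randomized algorithm `A` on streams; `A x ω` is the collection
of all outputs on input `x` if the random coins, distributed according to `P`, are `ω`. -/
def IsDP {d T : ℕ} {Ω : Type v} [MeasurableSpace Ω] (P : Measure Ω)
    {Out : Type u} [MeasurableSpace Out] (A : BinStream d T → Ω → Out) (ε δ : ℝ) : Prop :=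
  ∀ x y : BinStream d T, Neighboring x y → DPClose P (A x) (A y) ε δ

/-- The Laplace distribution centred at `0` with scale `b`. -/
def laplace (b : ℝ) : Measure ℝ :=
  volume.withDensity fun z => ENNReal.ofReal (1 / (2 * b) * Real.exp (-|z| / b))

/-! ## Continuous histogram mechanisms and the adaptive continual release model -/

/-- A randomized mechanism which at every time step receives a vector in `ℕ^d` and answers with a
vector in `ℝ^d`. The answer given right after the inputs `l = [x¹, …, x^t]` is `out ω l`, where `ω`
denotes the random coins of the mechanism; so it depends on the coins and on `x¹, …, x^t` only. -/
structure HistogramMechanism (d : ℕ) where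
  Ω : Type u
  [measurableSpace : MeasurableSpace Ω]
  P : Measure Ω
  [isProbabilityMeasure : IsProbabilityMeasure P]
  out : Ω → List (Fin d → ℕ) → (Fin d → ℝ)
  measurable_out : ∀ l : List (Fin d → ℕ), Measurable fun ω => out ω l

attribute [instance] HistogramMechanism.measurableSpace HistogramMechanism.isProbabilityMeasure

/-- The side of the privacy game. -/
inductive Side
  | left
  | right

/-- What the adversary outputs in one time step: a single input if the step is regular; a pair of
neighboring inputs (at sup-distance at most `1`) if the step is the challenge. -/
inductive Move (d : ℕ)
  | regular (u : Fin d → ℕ)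
  | challenge (uL uR : Fin d → ℕ) (close : ∀ i, uL i ≤ uR i + 1 ∧ uR i ≤ uL i + 1)

/-- There are only countably many moves; all sets of moves are measurable. -/
instance (d : ℕ) : MeasurableSpace (Move d) := ⊤

/-- The move is of type `challenge`. -/
def Move.IsChallenge {d : ℕ} : Move d → Prop
  | .regular _ => False
  | .challenge _ _ _ => True

/-- The input that the oracle passes on to the mechanism. -/
def Move.sent {d : ℕ} (side : Side) : Move d → (Fin d → ℕ)
  | .regular u => u
  | .challenge uL uR _ => match side with
    | .left => uL
    | .right => uR

/-- An adversary for the privacy game over `n` time steps. In time step `t` (counted from `0`) it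
chooses its move depending on its random coins and on the `t` answers of the mechanism that it has
seen so far. Exactly one of the `n` time steps is a challenge. -/
structure Adversary (d n : ℕ) where
  Coins : Type
  [measurableSpace : MeasurableSpace Coins]
  law : Measure Coins
  [isProbabilityMeasure : IsProbabilityMeasure law]
  move : (t : ℕ) → Coins → (Fin t → Fin d → ℝ) → Move d
  measurable_move : ∀ t : ℕ,
    Measurable fun p : Coins × (Fin t → Fin d → ℝ) => move t p.1 p.2
  exactly_one_challenge : ∀ (r : Coins) (a : ℕ → Fin d → ℝ),
    ∃! t : ℕ, t < n ∧ (move t r fun i : Fin t => a i).IsChallenge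

attribute [instance] Adversary.measurableSpace Adversary.isProbabilityMeasure

/-- The first `t` steps of the privacy game, for fixed coins `r` of the adversary and `ω` of the
mechanism: the inputs sent to the mechanism and the answers of the mechanism. -/
def play {d n : ℕ} (H : HistogramMechanism.{u} d) (Adv : Adversary d n) (side : Side)
    (r : Adv.Coins) (ω : H.Ω) : (t : ℕ) → List (Fin d → ℕ) × (Fin t → Fin d → ℝ)
  | 0 => ([], Fin.elim0)
  | t + 1 =>
    let past := play H Adv side r ω t
    let inputs := past.1 ++ [(Adv.move t r past.2).sent side]
    (inputs, Fin.snoc past.2 (H.out ω inputs))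

/-- The view of the adversary at the end of the game: its coins, its moves and the answers of the
mechanism. -/
def view {d n : ℕ} (H : HistogramMechanism.{u} d) (Adv : Adversary d n) (side : Side)
    (p : Adv.Coins × H.Ω) : Adv.Coins × (Fin n → Move d) × (Fin n → Fin d → ℝ) :=
  (p.1, (fun t => Adv.move t p.1 (play H Adv side p.1 p.2 t).2), (play H Adv side p.1 p.2 n).2)

/-- `H` is adaptively `(ε, δ)`-differentially private on streams of length `n`. -/
def IsAdaptivelyDP {d : ℕ} (H : HistogramMechanism.{u} d) (n : ℕ) (ε δ : ℝ) : Prop :=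
  ∀ Adv : Adversary d n,
    DPClose (Adv.law.prod H.P) (view H Adv .left) (view H Adv .right) ε δ ∧
    DPClose (Adv.law.prod H.P) (view H Adv .right) (view H Adv .left) ε δ

/-! ## The meta mechanism -/

/-- The variables of the meta mechanism: the list of the inputs inserted into `H` so far (so the
current interval has number `fed.length + 1`), the counts `c` within the current interval, and the
approximate histogram `s`. -/
structure MetaState (d : ℕ) where
  fed : List (Fin d → ℕ)
  c : Fin d → ℕ
  s : Fin d → ℝ

/-- The output in one time step: nothing, or, if an interval is closed, the new histogram. -/
abbrev StepOutput (d : ℕ) : Type := Unit ⊕ (Fin d → ℝ)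

/-- One time step of the meta mechanism, with the coins `ω` of `H`, the threshold noise `τ`, the
new element `xt` of the stream, and the noise `μt` for this time step. -/
def metaStep {d Δ : ℕ} (H : HistogramMechanism.{u} d) (K : Fin Δ → ℝ) (g : (Fin d → ℝ) → ℝ)
    (ω : H.Ω) (τ : Fin Δ → ℝ) (xt : Fin d → Fin 2) (μt : ℝ) (st : MetaState d) :
    MetaState d × StepOutput d :=
  let c' : Fin d → ℕ := fun i => st.c i + (xt i : ℕ)
  let s' : Fin d → ℝ := fun i => st.s i + ((xt i : ℕ) : ℝ)
  if ∃ h : st.fed.length < Δ,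
      g s' + μt > K ⟨st.fed.length, h⟩ + τ ⟨st.fed.length, h⟩ then
    let fed' := st.fed ++ [c']
    let s'' := H.out ω fed'
    (⟨fed', fun _ => 0, s''⟩, Sum.inr s'')
  else
    (⟨st.fed, c', s'⟩, Sum.inl ())

/-- The state of the meta mechanism after the first `t` time steps. -/
def metaState {d T Δ : ℕ} (H : HistogramMechanism.{u} d) (s₀ : Fin d → ℝ) (K : Fin Δ → ℝ)
    (g : (Fin d → ℝ) → ℝ) (x : BinStream d T) (ω : H.Ω) (τ : Fin Δ → ℝ) (μ : Fin T → ℝ) :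
    Fin (T + 1) → MetaState d :=
  Fin.induction ⟨[], fun _ => 0, s₀⟩
    fun t st => (metaStep H K g ω τ (x t) (μ t) st).1

/-- The coins of the meta mechanism: the coins of `H`, the noises `τ_j` added to the thresholds, and
the noises `μ_t` added to `g(s)`. -/
abbrev MetaCoins {d : ℕ} (H : HistogramMechanism.{u} d) (T Δ : ℕ) : Type u :=
  H.Ω × (Fin Δ → ℝ) × (Fin T → ℝ)

/-- All coins are independent, with `τ_j ~ Lap(4/ε)` and `μ_t ~ Lap(8/ε)`. -/
def metaCoinsLaw {d : ℕ} (H : HistogramMechanism.{u} d) (T Δ : ℕ) (ε : ℝ) :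
    Measure (MetaCoins H T Δ) :=
  H.P.prod
    ((Measure.pi fun _ : Fin Δ => laplace (4 / ε)).prod
      (Measure.pi fun _ : Fin T => laplace (8 / ε)))

/-- The meta mechanism: the outputs at all time steps. They show at which time steps an interval
is closed, and the histogram that `H` returns at that time. -/
def metaMechanism {d T Δ : ℕ} (H : HistogramMechanism.{u} d) (s₀ : Fin d → ℝ) (K : Fin Δ → ℝ)
    (g : (Fin d → ℝ) → ℝ) (x : BinStream d T) (coins : MetaCoins H T Δ) :
    Fin T → StepOutput d :=
  fun t => (metaStep H K g coins.1 coins.2.1 (x t) (coins.2.2 t)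
    (metaState H s₀ K g x coins.1 coins.2.1 coins.2.2 t.castSucc)).2

end ContinualDP

end

/-!
The privacy loss is split between the mechanism `H`, which receives the counts of the closed
intervals, and the noisy thresholds, which determine the closing times.

Let the streams `x` (left) and `y` (right) differ in time step `t₀` only. The hybrid run closes the
intervals at the times that `x` dictates, but inserts the counts of `y` into `H`. As the state `s` is
always the last answer of `H` plus the counts of the current interval, the noises and the answers of
`H` determine such a run. So an adversary that draws the noises as its coins can simulate the meta
mechanism, and its challenge is the interval that contains `t₀`, the only one whose counts differ.
The outputs are a function of its view (`outputsOfView_view`): on the left side they are the outputs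
of the meta mechanism on `x`, on the right side those of the hybrid run. This costs
`(ε / 2, δ / e ^ (ε / 2))`. The moves are computed from the answers received so far, since these
determine the run up to the next insertion (`run_exceeds_seqAnswer_congr`).

The hybrid run is compared to the meta mechanism on `y` for each set of closing times. Raise the
threshold noise of the interval that contains `t₀` by `1`, and the noise of the query at which it is
closed by `2`. As the two values of `g` differ by at most `1`, every output of the hybrid run is then
the output on `y` for the shifted noises (`outputs_exceeds_noiseShift`). Each of the two shifts
changes the density of the noises by a factor of at most `e ^ (ε / 4)`
(`map_add_const_noiseLaw_le`), so this step costs `(ε / 2, 0)` (`measure_hybrid_le`).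
-/

noncomputable section

namespace ContinualDP

/-! ### Translates of Laplace distributions -/

theorem lintegral_laplace_density {b : ℝ} (hb : 0 < b) :
    ∫⁻ z, ENNReal.ofReal (1 / (2 * b) * Real.exp (-|z| / b)) = 1 := by
  have hInt : ∫ z : ℝ, 1 / (2 * b) * Real.exp (-|z| / b) = 1 := by
    have h := integral_comp_abs (f := fun z : ℝ => 1 / (2 * b) * Real.exp (-z / b))
    rw [h, integral_const_mul]
    have h2 := integral_exp_mul_Ioi (a := -b⁻¹) (by simpa using hb) 0
    have h3 : ∀ z : ℝ, -z / b = -b⁻¹ * z := fun z => by field_simp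
    simp_rw [h3, h2]
    field_simp
    simp
  have hI : Integrable fun z : ℝ => 1 / (2 * b) * Real.exp (-|z| / b) := by
    by_contra h
    rw [integral_undef h] at hInt
    exact zero_ne_one hInt
  rw [← ofReal_integral_eq_lintegral_ofReal hI (.of_forall fun z => by positivity), hInt,
    ENNReal.ofReal_one]

theorem isProbabilityMeasure_laplace {b : ℝ} (hb : 0 < b) : IsProbabilityMeasure (laplace b) :=
  ⟨by rw [laplace, withDensity_apply _ .univ, Measure.restrict_univ, lintegral_laplace_density hb]⟩

theorem map_add_const_laplace_le {b : ℝ} (hb : 0 < b) (c : ℝ) :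
    (laplace b).map (· + c) ≤ ENNReal.ofReal (Real.exp (|c| / b)) • laplace b := by
  refine Measure.le_iff.2 fun s hs => ?_
  rw [Measure.map_apply (measurable_add_const c) hs, Measure.smul_apply, smul_eq_mul, laplace,
    withDensity_apply _ (measurable_add_const c hs), withDensity_apply _ hs,
    ← lintegral_const_mul _ (by fun_prop), ← lintegral_indicator (measurable_add_const c hs),
    ← lintegral_indicator hs]
  rw [← lintegral_add_right_eq_self (μ := volume) (s.indicator _) c]
  refine lintegral_mono fun z => ?_
  by_cases hz : z + c ∈ s
  · rw [Set.indicator_of_mem (by exact hz), Set.indicator_of_mem hz,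
      ← ENNReal.ofReal_mul (Real.exp_nonneg _)]
    refine ENNReal.ofReal_le_ofReal ?_
    rw [mul_left_comm, ← Real.exp_add, ← add_div]
    gcongr
    linarith [abs_add_le z c]
  · rw [Set.indicator_of_notMem (by exact hz)]
    exact zero_le

/-- The product measure is the restriction of the largest outer measure with prescribed bounds on
boxes, so it is monotone in its factors. -/
theorem pi_le_pi {ι : Type*} [Fintype ι] {α : ι → Type*} [∀ i, MeasurableSpace (α i)]
    {μ ν : ∀ i, Measure (α i)} [∀ i, SigmaFinite (μ i)] (h : ∀ i, μ i ≤ ν i) :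
    Measure.pi μ ≤ Measure.pi ν := by
  refine Measure.le_iff.2 fun s hs => ?_
  rw [Measure.pi, Measure.pi, toMeasure_apply _ _ hs, toMeasure_apply _ _ hs]
  refine OuterMeasure.le_pi.2 (fun t _ => ?_) s
  exact (OuterMeasure.pi_pi_le _ _).trans (Finset.prod_le_prod' fun i _ => h i (t i))

theorem pi_smul {ι : Type*} [Fintype ι] {α : ι → Type*} [∀ i, MeasurableSpace (α i)]
    (μ : ∀ i, Measure (α i)) [∀ i, IsFiniteMeasure (μ i)] (c : ι → NNReal) :
    Measure.pi (fun i => c i • μ i) = (∏ i, c i) • Measure.pi μ := by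
  refine Measure.pi_eq fun s _ => ?_
  rw [Measure.smul_apply, Measure.pi_pi, ENNReal.smul_def, smul_eq_mul, ENNReal.ofNNReal_finsetProd,
    ← Finset.prod_mul_distrib]
  rfl

/-- Translating independent Laplace noises by `v` costs a factor depending on the `ℓ¹`-norm of
`v`. -/
theorem map_add_const_pi_laplace_le {b : ℝ} (hb : 0 < b) {n : ℕ} (v : Fin n → ℝ) {B : ℝ}
    (hv : ∑ i, |v i| ≤ B) :
    (Measure.pi fun _ : Fin n => laplace b).map (· + v) ≤
      ENNReal.ofReal (Real.exp (B / b)) • Measure.pi fun _ : Fin n => laplace b := by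
  have := isProbabilityMeasure_laplace hb
  have hmap : (Measure.pi fun _ : Fin n => laplace b).map (· + v) =
      Measure.pi fun i => (laplace b).map (· + v i) := by
    have h (i : Fin n) : IsProbabilityMeasure ((laplace b).map (· + v i)) :=
      Measure.isProbabilityMeasure_map (by fun_prop)
    exact Measure.pi_map_pi (μ := fun _ : Fin n => laplace b) (f := fun i z => z + v i)
      (fun i => by fun_prop)
  have h (i : Fin n) : IsProbabilityMeasure ((laplace b).map (· + v i)) :=
    Measure.isProbabilityMeasure_map (by fun_prop)
  rw [hmap]
  refine (pi_le_pi fun i => map_add_const_laplace_le hb (v i)).trans ?_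
  have h2 := pi_smul (fun _ : Fin n => laplace b) (fun i => (Real.exp (|v i| / b)).toNNReal)
  refine (le_of_eq h2).trans ?_
  rw [← Real.toNNReal_prod_of_nonneg fun i _ => Real.exp_nonneg _, ← Real.exp_sum,
    ← Finset.sum_div]
  refine Measure.le_iff.2 fun s _ => ?_
  rw [Measure.smul_apply, Measure.smul_apply, smul_eq_mul, ENNReal.smul_def, smul_eq_mul]
  gcongr
  exact ENNReal.ofReal_le_ofReal (by gcongr)

/-- The joint law of the threshold noises and of the noises added to the queries. -/
def noiseLaw (T Δ : ℕ) (ε : ℝ) : Measure ((Fin Δ → ℝ) × (Fin T → ℝ)) :=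
  (Measure.pi fun _ : Fin Δ => laplace (4 / ε)).prod (Measure.pi fun _ : Fin T => laplace (8 / ε))

theorem isProbabilityMeasure_noiseLaw {T Δ : ℕ} {ε : ℝ} (hε : 0 < ε) :
    IsProbabilityMeasure (noiseLaw T Δ ε) := by
  have := isProbabilityMeasure_laplace (b := 4 / ε) (by positivity)
  have := isProbabilityMeasure_laplace (b := 8 / ε) (by positivity)
  unfold noiseLaw
  infer_instance

theorem map_add_const_noiseLaw_le {T Δ : ℕ} {ε : ℝ} (hε : 0 < ε) {v : Fin Δ → ℝ} {w : Fin T → ℝ}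
    (hv : ∑ i, |v i| ≤ 1) (hw : ∑ i, |w i| ≤ 2) :
    (noiseLaw T Δ ε).map (· + (v, w)) ≤
      ENNReal.ofReal (Real.exp (ε / 2)) • noiseLaw T Δ ε := by
  have := isProbabilityMeasure_laplace (b := 4 / ε) (by positivity)
  have := isProbabilityMeasure_laplace (b := 8 / ε) (by positivity)
  have hmap : (noiseLaw T Δ ε).map (· + (v, w)) =
      ((Measure.pi fun _ : Fin Δ => laplace (4 / ε)).map (· + v)).prod
        ((Measure.pi fun _ : Fin T => laplace (8 / ε)).map (· + w)) :=
    (Measure.map_prod_map _ _ (measurable_add_const v) (measurable_add_const w)).symm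
  have h1 := map_add_const_pi_laplace_le (b := 4 / ε) (by positivity) v hv
  have h2 := map_add_const_pi_laplace_le (b := 8 / ε) (by positivity) w hw
  rw [hmap]
  have : SFinite (ENNReal.ofReal (Real.exp (2 / (8 / ε))) •
      Measure.pi fun _ : Fin T => laplace (8 / ε)) := by
    rw [ENNReal.ofReal, ← ENNReal.smul_def]
    infer_instance
  refine (Measure.prod_mono h1 h2).trans ?_
  refine Measure.le_iff.2 fun s _ => ?_
  rw [Measure.prod_smul_left, Measure.prod_smul_right, smul_smul, ← ENNReal.ofReal_mul
    (Real.exp_nonneg _), ← Real.exp_add,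
    show 1 / (4 / ε) + 2 / (8 / ε) = ε / 2 by field_simp; norm_num]
  rfl

/-! ### Runs on two streams with common closing times -/

/-- The discrete part of the state of a run on two streams at once, in which both streams have their
intervals closed at the same times: the vectors inserted so far, and the counts within the current
interval, each for both streams. -/
structure Record (d : ℕ) where
  fed : List (Side → Fin d → ℕ)
  cur : Side → Fin d → ℕ

instance : Finite Side :=
  Finite.of_surjective (fun b : Bool => if b then Side.left else Side.right)
    (by rintro (_ | _); exacts [⟨true, rfl⟩, ⟨false, rfl⟩])

instance (d : ℕ) : Countable (Record d) :=
  Function.Injective.countable (f := fun r : Record d => (r.fed, r.cur))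
    (by rintro ⟨_, _⟩ ⟨_, _⟩ h; simpa using h)

/-- Add the new elements of the streams to the counts of the current interval. -/
def Record.add {d : ℕ} (r : Record d) (w : Side → Fin d → ℕ) : Record d := ⟨r.fed, r.cur + w⟩

/-- Close the current interval. -/
def Record.close {d : ℕ} (r : Record d) : Record d := ⟨r.fed ++ [r.cur], 0⟩

open Classical in
/-- The record after the first `t` time steps, if `w` gives the two streams and if the interval is
closed at time `t` exactly when `dec t r` holds, where `r` is the record at this time, with the
elements `w t` already added. -/
def run {d : ℕ} (w : ℕ → Side → Fin d → ℕ) (dec : ℕ → Record d → Prop) : ℕ → Record d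
  | 0 => ⟨[], 0⟩
  | t + 1 =>
    let r := (run w dec t).add (w t)
    if dec t r then r.close else r

/-- The record in time step `t`, after the elements `w t` are added, and before the interval is
possibly closed. -/
def pending {d : ℕ} (w : ℕ → Side → Fin d → ℕ) (dec : ℕ → Record d → Prop) (t : ℕ) : Record d :=
  (run w dec t).add (w t)

open Classical in
/-- The outputs of a run if `ans l` is the answer to the insertions `l`. -/
def outputs {d : ℕ} (T : ℕ) (w : ℕ → Side → Fin d → ℕ) (dec : ℕ → Record d → Prop)
    (ans : List (Side → Fin d → ℕ) → Fin d → ℝ) : Fin T → StepOutput d :=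
  fun t => if dec t (pending w dec t) then Sum.inr (ans (pending w dec t).close.fed)
    else Sum.inl ()

section Run

variable {d : ℕ} {w : ℕ → Side → Fin d → ℕ} {dec dec' : ℕ → Record d → Prop}

theorem run_succ_of_pos {t : ℕ} (h : dec t (pending w dec t)) :
    run w dec (t + 1) = (pending w dec t).close := if_pos h

theorem run_succ_of_neg {t : ℕ} (h : ¬ dec t (pending w dec t)) :
    run w dec (t + 1) = pending w dec t := if_neg h

theorem run_prefix_succ (w : ℕ → Side → Fin d → ℕ) (dec : ℕ → Record d → Prop) (t : ℕ) :
    (run w dec t).fed <+: (run w dec (t + 1)).fed := by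
  by_cases h : dec t (pending w dec t)
  · rw [run_succ_of_pos h]
    exact List.prefix_append _ _
  · rw [run_succ_of_neg h]
    exact List.prefix_rfl

theorem run_prefix (w : ℕ → Side → Fin d → ℕ) (dec : ℕ → Record d → Prop) {t t' : ℕ}
    (h : t ≤ t') : (run w dec t).fed <+: (run w dec t').fed := by
  induction t', h using Nat.le_induction with
  | base => exact List.prefix_rfl
  | succ n _ ih => exact ih.trans (run_prefix_succ w dec n)

theorem run_congr {n : ℕ}
    (h : ∀ t < n, (dec t (pending w dec t) ↔ dec' t (pending w dec t))) :
    ∀ t ≤ n, run w dec t = run w dec' t := by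
  intro t
  induction t with
  | zero => intro _; rfl
  | succ t ih =>
    intro ht
    have hr := ih (by omega)
    have hd := h t ht
    have hp : pending w dec' t = pending w dec t := by rw [pending, pending, hr]
    by_cases hc : dec t (pending w dec t)
    · rw [run_succ_of_pos hc, run_succ_of_pos (hp ▸ hd.1 hc), hp]
    · rw [run_succ_of_neg hc, run_succ_of_neg (hp ▸ fun h' => hc (hd.2 h')), hp]

theorem outputs_congr {T : ℕ} {ans ans' : List (Side → Fin d → ℕ) → Fin d → ℝ}
    (h : ∀ t < T, (dec t (pending w dec t) ↔ dec' t (pending w dec t)))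
    (hans : ∀ t < T, dec t (pending w dec t) →
      ans (pending w dec t).close.fed = ans' (pending w dec t).close.fed) :
    outputs T w dec ans = outputs T w dec' ans' := by
  funext t
  have hp : pending w dec' t = pending w dec t := by
    rw [pending, pending, run_congr h t t.2.le]
  by_cases hd : dec t (pending w dec t)
  · rw [outputs, outputs, if_pos hd, if_pos (hp ▸ (h t t.2).1 hd), hp, hans t t.2 hd]
  · rw [outputs, outputs, if_neg hd, if_neg (hp ▸ fun h' => hd ((h t t.2).2 h'))]

theorem length_run_le {Δ : ℕ} (h : ∀ t r, dec t r → r.fed.length < Δ) (t : ℕ) :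
    (run w dec t).fed.length ≤ Δ := by
  induction t with
  | zero => exact Nat.zero_le _
  | succ t ih =>
    by_cases hd : dec t (pending w dec t)
    · have := h _ _ hd
      rw [run_succ_of_pos hd]
      simpa [Record.close] using this
    · rwa [run_succ_of_neg hd]

theorem length_run_eq_count (w : ℕ → Side → Fin d → ℕ) {p : ℕ → Prop} [DecidablePred p] {n : ℕ}
    (hp : ∀ t < n, (p t ↔ dec t (pending w dec t))) {t : ℕ} (ht : t ≤ n) :
    (run w dec t).fed.length = Nat.count p t := by
  induction t with
  | zero => simp [run]
  | succ t ih =>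
    have hl := ih (by omega)
    rw [Nat.count_succ, ← hl]
    by_cases hd : dec t (pending w dec t)
    · rw [run_succ_of_pos hd, if_pos ((hp t ht).2 hd)]
      simp [Record.close, pending, Record.add]
    · rw [run_succ_of_neg hd, if_neg (fun h => hd ((hp t ht).1 h))]
      rfl

end Run

/-! ### Two streams that differ in one time step -/

/-- Both components of the pair of vectors are equal. -/
def Agree {d : ℕ} (e : Side → Fin d → ℕ) : Prop := e .left = e .right

/-- The components of the pair of vectors have sup-distance at most `1`. -/
def Near {d : ℕ} (e : Side → Fin d → ℕ) : Prop :=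
  ∀ i, e .left i ≤ e .right i + 1 ∧ e .right i ≤ e .left i + 1

theorem Agree.near {d : ℕ} {e : Side → Fin d → ℕ} (h : Agree e) : Near e := by
  intro i
  have := congrFun h i
  omega

theorem Agree.add {d : ℕ} {e f : Side → Fin d → ℕ} (he : Agree e) (hf : Agree f) :
    Agree (e + f) := congrArg₂ (· + ·) he hf

theorem Near.add_agree {d : ℕ} {e f : Side → Fin d → ℕ} (he : Near e) (hf : Agree f) :
    Near (e + f) := by
  intro i
  have h1 := he i
  have h2 := congrFun hf i
  simp only [Pi.add_apply]
  omega

theorem Agree.add_near {d : ℕ} {e f : Side → Fin d → ℕ} (he : Agree e) (hf : Near f) :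
    Near (e + f) := by
  rw [add_comm]
  exact hf.add_agree he

section Neighbors

variable {d : ℕ} {w : ℕ → Side → Fin d → ℕ} {t₀ : ℕ}

/-- Only the interval that contains the time step `t₀` at which the streams differ has different
counts, and these differ by at most `1`. Here `N` is the number of intervals closed before
`t₀`. -/
theorem run_agree_near (dec : ℕ → Record d → Prop) (hw : ∀ t ≠ t₀, Agree (w t))
    (hw₀ : Near (w t₀)) {N : ℕ} (hN : (run w dec t₀).fed.length = N) (t : ℕ) :
    ((∀ k e, (run w dec t).fed[k]? = some e → Near e ∧ (k ≠ N → Agree e)) ∧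
      Near (run w dec t).cur ∧
      (t ≤ t₀ ∨ (run w dec t).fed.length ≠ N → Agree (run w dec t).cur)) ∧
    Near (pending w dec t).cur ∧
    ((run w dec t).fed.length ≠ N → Agree (pending w dec t).cur) := by
  have key : ∀ t, ((∀ k e, (run w dec t).fed[k]? = some e → Near e ∧ (k ≠ N → Agree e)) ∧
      Near (run w dec t).cur ∧
      (t ≤ t₀ ∨ (run w dec t).fed.length ≠ N → Agree (run w dec t).cur)) →
      Near (pending w dec t).cur ∧
      (t + 1 ≤ t₀ ∨ (run w dec t).fed.length ≠ N → Agree (pending w dec t).cur) := by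
    rintro t ⟨-, hc, ha⟩
    refine ⟨?_, fun h => ?_⟩
    · by_cases ht : t = t₀
      · exact (ha (.inl ht.le)).add_near (ht ▸ hw₀)
      · exact hc.add_agree (hw t ht)
    · have ht : t ≠ t₀ := by
        rintro rfl
        omega
      exact (ha (h.imp_left fun h => by omega)).add (hw t ht)
  have main : ∀ t, ((∀ k e, (run w dec t).fed[k]? = some e → Near e ∧ (k ≠ N → Agree e)) ∧
      Near (run w dec t).cur ∧
      (t ≤ t₀ ∨ (run w dec t).fed.length ≠ N → Agree (run w dec t).cur)) := by
    intro t
    induction t with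
    | zero =>
      exact ⟨fun k e h => by simp [run] at h, Agree.near rfl, fun _ => rfl⟩
    | succ t ih =>
      obtain ⟨h1, h2⟩ := key t ih
      by_cases hd : dec t (pending w dec t)
      · rw [run_succ_of_pos hd]
        refine ⟨fun k e h => ?_, Agree.near rfl, fun _ => rfl⟩
        change ((run w dec t).fed ++ [(pending w dec t).cur])[k]? = some e at h
        rw [List.getElem?_append] at h
        split_ifs at h with hk
        · exact ih.1 k e h
        · obtain ⟨hk', rfl⟩ := List.getElem?_eq_some_iff.1 h
          have : k = (run w dec t).fed.length := by
            simp only [List.length_singleton] at hk'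
            omega
          simp only [List.getElem_singleton]
          exact ⟨h1, fun hkN => h2 (.inr (this ▸ hkN))⟩
      · rw [run_succ_of_neg hd]
        exact ⟨ih.1, h1, h2⟩
  exact ⟨main t, (key t (main t)).1, fun h => (key t (main t)).2 (.inr h)⟩

end Neighbors

/-! ### Closing intervals by noisy thresholds -/

section Exceeds

variable {d T Δ : ℕ}

/-- The approximate histogram `s`: the initial vector or the last answer, plus the counts of the
current interval. -/
def estimate (s₀ : Fin d → ℝ) (ans : List (Side → Fin d → ℕ) → Fin d → ℝ) (side : Side)
    (r : Record d) : Fin d → ℝ :=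
  (if r.fed = [] then s₀ else ans r.fed) + fun i => (r.cur side i : ℝ)

/-- The condition under which the meta mechanism closes the interval at time `t`, where `r` is the
record with the elements of time `t` already added. -/
def Exceeds (s₀ : Fin d → ℝ) (K : Fin Δ → ℝ) (g : (Fin d → ℝ) → ℝ) (side : Side)
    (ans : List (Side → Fin d → ℕ) → Fin d → ℝ) (noise : (Fin Δ → ℝ) × (Fin T → ℝ))
    (t : ℕ) (r : Record d) : Prop :=
  ∃ (h : r.fed.length < Δ) (ht : t < T),
    g (estimate s₀ ans side r) + noise.2 ⟨t, ht⟩ > K ⟨_, h⟩ + noise.1 ⟨_, h⟩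

/-- The answers of `H` to the insertions of one side. -/
def mechAnswer (H : HistogramMechanism.{u} d) (ω : H.Ω) (side : Side)
    (l : List (Side → Fin d → ℕ)) : Fin d → ℝ :=
  H.out ω (l.map fun e => e side)

/-- Answers prescribed by a sequence: `a k` is the answer to the insertion with index `k`, that is,
to a list of `k + 1` insertions. -/
def seqAnswer (a : ℕ → Fin d → ℝ) (l : List (Side → Fin d → ℕ)) : Fin d → ℝ :=
  a (l.length - 1)

variable {s₀ : Fin d → ℝ} {K : Fin Δ → ℝ} {g : (Fin d → ℝ) → ℝ}

theorem exceeds_congr {side : Side} {ans ans' : List (Side → Fin d → ℕ) → Fin d → ℝ}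
    (noise : (Fin Δ → ℝ) × (Fin T → ℝ)) (t : ℕ) {r : Record d}
    (h : r.fed ≠ [] → ans r.fed = ans' r.fed) :
    Exceeds s₀ K g side ans noise t r ↔ Exceeds s₀ K g side ans' noise t r := by
  have : estimate s₀ ans side r = estimate s₀ ans' side r := by
    by_cases h0 : r.fed = []
    · simp only [estimate, if_pos h0]
    · simp only [estimate, if_neg h0, h h0]
  simp only [Exceeds, this]

/-- The first `k` answers determine the run up to the insertion with index `k`. -/
theorem run_exceeds_seqAnswer_congr (w : ℕ → Side → Fin d → ℕ) (side : Side)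
    (noise : (Fin Δ → ℝ) × (Fin T → ℝ)) {a a' : ℕ → Fin d → ℝ} {k : ℕ}
    (h : ∀ i < k, a i = a' i) (t : ℕ) :
    let r := run w (Exceeds s₀ K g side (seqAnswer a) noise) t
    let r' := run w (Exceeds s₀ K g side (seqAnswer a') noise) t
    r = r' ∨ (k < r.fed.length ∧ k < r'.fed.length ∧
      r.fed.take (k + 1) = r'.fed.take (k + 1)) := by
  intro r r'
  induction t with
  | zero => exact .inl rfl
  | succ t ih =>
    set q := run w (Exceeds s₀ K g side (seqAnswer a) noise) t with hq
    set q' := run w (Exceeds s₀ K g side (seqAnswer a') noise) t with hq'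
    have hlong : k < q.fed.length → k < q'.fed.length →
        q.fed.take (k + 1) = q'.fed.take (k + 1) →
        k < r.fed.length ∧ k < r'.fed.length ∧ r.fed.take (k + 1) = r'.fed.take (k + 1) := by
      intro h1 h2 h3
      obtain ⟨m, hm⟩ := run_prefix_succ w (Exceeds s₀ K g side (seqAnswer a) noise) t
      obtain ⟨m', hm'⟩ := run_prefix_succ w (Exceeds s₀ K g side (seqAnswer a') noise) t
      rw [← hq] at hm
      rw [← hq'] at hm'
      change q.fed ++ m = r.fed at hm
      change q'.fed ++ m' = r'.fed at hm'
      rw [← hm, ← hm', List.take_append_of_le_length h1, List.take_append_of_le_length h2]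
      simp only [List.length_append]
      exact ⟨by omega, by omega, h3⟩
    rcases ih with ih | ⟨h1, h2, h3⟩
    · by_cases hk : q.fed.length ≤ k
      · left
        have hdec : Exceeds s₀ K g side (seqAnswer a) noise t (q.add (w t)) ↔
            Exceeds s₀ K g side (seqAnswer a') noise t (q.add (w t)) := by
          refine exceeds_congr noise t fun hne => h _ ?_
          have := List.length_pos_iff.2 hne
          change 0 < q.fed.length at this
          change q.fed.length - 1 < k
          omega
        change run w _ (t + 1) = run w _ (t + 1)
        have hp : pending w (Exceeds s₀ K g side (seqAnswer a') noise) t = q.add (w t) :=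
          congrArg (fun r => Record.add r (w t)) ih.symm
        by_cases hd : Exceeds s₀ K g side (seqAnswer a) noise t (q.add (w t))
        · rw [run_succ_of_pos hd, run_succ_of_pos (hp ▸ hdec.1 hd), hp]
          rfl
        · rw [run_succ_of_neg hd, run_succ_of_neg (hp ▸ fun h' => hd (hdec.2 h')), hp]
          rfl
      · have hk' := hk
        rw [ih] at hk'
        exact .inr (hlong (by omega) (by omega) (by rw [ih]))
    · exact .inr (hlong h1 h2 h3)

/-- The meta mechanism on a stream is a run in which this stream is one of the two sides. -/
theorem metaMechanism_eq_outputs (H : HistogramMechanism.{u} d) (x : BinStream d T)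
    {w : ℕ → Side → Fin d → ℕ} {side : Side} (hw : ∀ (t : Fin T) i, w t side i = (x t i : ℕ))
    (ω : H.Ω) (noise : (Fin Δ → ℝ) × (Fin T → ℝ)) :
    metaMechanism H s₀ K g x (ω, noise) =
      outputs T w (Exceeds s₀ K g side (mechAnswer H ω side) noise) (mechAnswer H ω side) := by
  set dec := Exceeds s₀ K g side (mechAnswer H ω side) noise with hdec
  let state (r : Record d) : MetaState d :=
    ⟨r.fed.map fun e => e side, r.cur side, estimate s₀ (mechAnswer H ω side) side r⟩
  have hstep (t : Fin T) : metaStep H K g ω noise.1 (x t) (noise.2 t) (state (run w dec t)) =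
      (state (run w dec (t + 1)), outputs T w dec (mechAnswer H ω side) t) := by
    have hs : (fun i => (state (run w dec t)).s i + ((x t i : ℕ) : ℝ)) =
        (state (pending w dec t)).s := by
      funext i
      simp only [state, estimate, pending, Record.add, Pi.add_apply, hw]
      push_cast
      exact add_assoc _ _ _
    have hc : (fun i => (state (run w dec t)).c i + (x t i : ℕ)) =
        (state (pending w dec t)).c := by
      funext i
      simp only [state, pending, Record.add, Pi.add_apply, hw]
    have hiff : (∃ h : (state (run w dec t)).fed.length < Δ,
        g (state (pending w dec t)).s + noise.2 t > K ⟨_, h⟩ + noise.1 ⟨_, h⟩) ↔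
        dec t (pending w dec t) := by
      simp only [state, hdec, Exceeds, pending, Record.add, List.length_map, Fin.is_lt,
        exists_true_left, Fin.eta]
    simp only [metaStep, hs, hc]
    by_cases h : dec t (pending w dec t)
    · rw [if_pos (hiff.2 h), run_succ_of_pos h, outputs, if_pos h]
      have hfed : (state (pending w dec t).close).fed =
          (state (run w dec t)).fed ++ [(state (pending w dec t)).c] := List.map_append
      have hest : (state (pending w dec t).close).s =
          H.out ω (state (pending w dec t).close).fed := by
        have hne : (pending w dec t).close.fed ≠ [] :=
          List.append_ne_nil_of_right_ne_nil _ (List.cons_ne_nil _ _)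
        funext i
        simp only [state, estimate, if_neg hne, mechAnswer, Pi.add_apply]
        simp [Record.close]
      rw [← hfed, ← hest]
      exact Prod.ext rfl (congrArg Sum.inr hest)
    · rw [if_neg (fun h' => h (hiff.1 h')), run_succ_of_neg h, outputs, if_neg h]
      rfl
  have hstate (t : Fin (T + 1)) :
      metaState H s₀ K g x ω noise.1 noise.2 t = state (run w dec t) := by
    induction t using Fin.induction with
    | zero =>
      simp only [metaState, Fin.induction_zero, state]
      have : run w dec ((0 : Fin (T + 1)) : ℕ) = ⟨[], 0⟩ := rfl
      rw [this]
      simp only [estimate, List.map_nil, if_true, MetaState.mk.injEq, true_and]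
      constructor
      · rfl
      · funext i
        simp
    | succ t ih =>
      have := hstep t
      rw [metaState, Fin.induction_succ]
      rw [metaState] at ih
      rw [ih]
      exact congrArg Prod.fst this
  funext t
  rw [metaMechanism, hstate]
  exact congrArg Prod.snd (hstep t)

end Exceeds

/-! ### Measurability of runs -/

theorem measurableSet_setOf_countable {α β : Type*} [MeasurableSpace α] [Countable β] {X : α → β}
    (hX : ∀ b, MeasurableSet {a | X a = b}) {Q : β → α → Prop}
    (hQ : ∀ b, MeasurableSet {a | Q b a}) : MeasurableSet {a | Q (X a) a} := by
  have : {a | Q (X a) a} = ⋃ b, {a | X a = b} ∩ {a | Q b a} := by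
    ext a
    simp
  rw [this]
  exact .iUnion fun b => (hX b).inter (hQ b)

section Measurability

variable {α : Type*} [MeasurableSpace α] {d T Δ : ℕ}

theorem measurableSet_run_eq (w : ℕ → Side → Fin d → ℕ) {dec : α → ℕ → Record d → Prop}
    (h : ∀ t r, MeasurableSet {p | dec p t r}) (t : ℕ) (r : Record d) :
    MeasurableSet {p | run w (dec p) t = r} := by
  induction t generalizing r with
  | zero => exact .const ((⟨[], 0⟩ : Record d) = r)
  | succ t ih =>
    refine measurableSet_setOf_countable ih
      (Q := fun q p => (open Classical in if dec p t (q.add (w t)) then (q.add (w t)).close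
        else q.add (w t)) = r) fun q => ?_
    have : {p | (open Classical in if dec p t (q.add (w t)) then (q.add (w t)).close
        else q.add (w t)) = r} =
        ({p | dec p t (q.add (w t))} ∩ {_p | (q.add (w t)).close = r}) ∪
        ({p | dec p t (q.add (w t))}ᶜ ∩ {_p | q.add (w t) = r}) := by
      ext p
      by_cases hd : dec p t (q.add (w t)) <;> simp [hd]
    rw [this]
    exact ((h _ _).inter (.const _)).union ((h _ _).compl.inter (.const _))

theorem measurable_outputs (w : ℕ → Side → Fin d → ℕ) {dec : α → ℕ → Record d → Prop}
    {ans : α → List (Side → Fin d → ℕ) → Fin d → ℝ}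
    (h : ∀ t r, MeasurableSet {p | dec p t r}) (hans : ∀ l, Measurable fun p => ans p l) :
    Measurable fun p => outputs T w (dec p) (ans p) := by
  refine measurable_pi_iff.2 fun t s hs => ?_
  refine measurableSet_setOf_countable (measurableSet_run_eq w h t)
    (Q := fun q p => (open Classical in if dec p t (q.add (w t))
      then (Sum.inr (ans p (q.add (w t)).close.fed) : StepOutput d) else Sum.inl ()) ∈ s)
    fun q => ?_
  exact (Measurable.ite (h _ _) (measurable_inr.comp (hans _)) measurable_const) hs

theorem measurableSet_exceeds {s₀ : Fin d → ℝ} {K : Fin Δ → ℝ} {g : (Fin d → ℝ) → ℝ}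
    (hg : Measurable g) (side : Side) {ans : α → List (Side → Fin d → ℕ) → Fin d → ℝ}
    {noise : α → (Fin Δ → ℝ) × (Fin T → ℝ)} (hans : ∀ l, Measurable fun p => ans p l)
    (hnoise : Measurable noise) (t : ℕ) (r : Record d) :
    MeasurableSet {p | Exceeds s₀ K g side (ans p) (noise p) t r} := by
  by_cases h : r.fed.length < Δ ∧ t < T
  · have hset : {p | Exceeds s₀ K g side (ans p) (noise p) t r} =
        {p | K ⟨_, h.1⟩ + (noise p).1 ⟨_, h.1⟩ <
          g (estimate s₀ (ans p) side r) + (noise p).2 ⟨t, h.2⟩} := by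
      ext p
      exact ⟨fun ⟨_, _, h⟩ => h, fun h' => ⟨h.1, h.2, h'⟩⟩
    have hest : Measurable fun p => estimate s₀ (ans p) side r := by
      unfold estimate
      by_cases h0 : r.fed = []
      · simp only [if_pos h0]
        exact measurable_const
      · simp only [if_neg h0]
        exact (hans _).add_const _
    rw [hset]
    refine measurableSet_lt ?_ ?_
    · exact ((measurable_pi_apply _).comp hnoise.fst).const_add _
    · exact (hg.comp hest).add ((measurable_pi_apply _).comp hnoise.snd)
  · have hset : {p | Exceeds s₀ K g side (ans p) (noise p) t r} = ∅ := by
      ext p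
      exact ⟨fun ⟨h1, h2, _⟩ => h ⟨h1, h2⟩, False.elim⟩
    rw [hset]
    exact .empty

theorem measurable_metaMechanism (H : HistogramMechanism.{u} d) (s₀ : Fin d → ℝ) (K : Fin Δ → ℝ)
    {g : (Fin d → ℝ) → ℝ} (hg : Measurable g) (x : BinStream d T) :
    Measurable (metaMechanism H s₀ K g x) := by
  let w (t : ℕ) (_ : Side) (i : Fin d) : ℕ := if h : t < T then x ⟨t, h⟩ i else 0
  have heq : metaMechanism H s₀ K g x = fun p : MetaCoins H T Δ =>
      outputs T w (Exceeds s₀ K g .left (mechAnswer H p.1 .left) p.2)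
        (mechAnswer H p.1 .left) := by
    funext p
    exact metaMechanism_eq_outputs H x (fun t i => by simp [w]) p.1 p.2
  have hans (l) : Measurable fun p : MetaCoins H T Δ => mechAnswer H p.1 .left l :=
    (H.measurable_out _).comp measurable_fst
  rw [heq]
  exact measurable_outputs w (measurableSet_exceeds hg .left hans measurable_snd) hans

end Measurability

/-! ### The adversary that simulates the meta mechanism -/

section Game

variable {d T Δ : ℕ}

/-- A finite sequence of answers, continued by zeros. -/
def extend {k : ℕ} (a : Fin k → Fin d → ℝ) (i : ℕ) : Fin d → ℝ :=
  if h : i < k then a ⟨i, h⟩ else 0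

theorem extend_of_lt {k i : ℕ} (a : ℕ → Fin d → ℝ) (h : i < k) :
    extend (fun i : Fin k => a i) i = a i := dif_pos h

theorem measurable_extend (k i : ℕ) : Measurable fun a : Fin k → Fin d → ℝ => extend a i := by
  by_cases h : i < k
  · simp only [extend, dif_pos h]
    exact measurable_pi_apply _
  · simp only [extend, dif_neg h]
    exact measurable_const

/-- The run in which the left stream decides about closing intervals, for the answers `a`. -/
def gameRun (s₀ : Fin d → ℝ) (K : Fin Δ → ℝ) (g : (Fin d → ℝ) → ℝ) (w : ℕ → Side → Fin d → ℕ)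
    (noise : (Fin Δ → ℝ) × (Fin T → ℝ)) (a : ℕ → Fin d → ℝ) : ℕ → Record d :=
  run w (Exceeds s₀ K g .left (seqAnswer a) noise)

/-- The pair of vectors inserted with index `k`, or zeros if there are at most `k` insertions. -/
def Record.entry (r : Record d) (k : ℕ) : Side → Fin d → ℕ := r.fed[k]?.getD 0

open Classical in
/-- The move that submits the pair `e` as a challenge if `c` holds, and its left component as a
regular input otherwise. -/
def moveOf (c : Prop) (e : Side → Fin d → ℕ) : Move d :=
  if h : c ∧ Near e then .challenge (e .left) (e .right) h.2 else .regular (e .left)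

theorem isChallenge_moveOf {c : Prop} {e : Side → Fin d → ℕ} (he : Near e) :
    (moveOf c e).IsChallenge ↔ c := by
  by_cases hc : c
  · simp [moveOf, hc, he, Move.IsChallenge]
  · simp [moveOf, hc, Move.IsChallenge]

theorem sent_moveOf {c : Prop} {e : Side → Fin d → ℕ} (he : Near e) (h : ¬ c → Agree e)
    (side : Side) : (moveOf c e).sent side = e side := by
  by_cases hc : c
  · cases side <;> simp [moveOf, hc, he, Move.sent]
  · cases side
    · simp [moveOf, hc, Move.sent]
    · simpa [moveOf, hc, Move.sent, Agree] using h hc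

variable (s₀ : Fin d → ℝ) (K : Fin Δ → ℝ) (g : (Fin d → ℝ) → ℝ) (w : ℕ → Side → Fin d → ℕ)
  (t₀ : ℕ)

/-- The move with index `k`: the insertion with index `k` into `H`, computed from the noises and the
answers received so far. The challenge is the interval that contains `t₀`; if all intervals are
closed before `t₀`, then the last insertion, whose two components coincide, serves as the
challenge. -/
def gameMove (k : ℕ) (noise : (Fin Δ → ℝ) × (Fin T → ℝ)) (a : Fin k → Fin d → ℝ) : Move d :=
  moveOf (min (gameRun s₀ K g w noise (extend a) t₀).fed.length (Δ - 1) = k)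
    ((gameRun s₀ K g w noise (extend a) T).entry k)

variable {s₀ K g w t₀}

theorem measurable_gameMove (hg : Measurable g) (k : ℕ) :
    Measurable fun p : ((Fin Δ → ℝ) × (Fin T → ℝ)) × (Fin k → Fin d → ℝ) =>
      gameMove s₀ K g w t₀ k p.1 p.2 := by
  intro s _
  have hrun := measurableSet_run_eq w (measurableSet_exceeds (s₀ := s₀) (K := K) hg .left
    (ans := fun p : ((Fin Δ → ℝ) × (Fin T → ℝ)) × (Fin k → Fin d → ℝ) => seqAnswer (extend p.2))
    (fun l => (measurable_extend k (l.length - 1)).comp measurable_snd) measurable_fst)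
  refine measurableSet_setOf_countable (hrun T)
    (Q := fun q p => moveOf (min (gameRun s₀ K g w p.1 (extend p.2) t₀).fed.length (Δ - 1) = k)
      (q.entry k) ∈ s) fun q => ?_
  exact measurableSet_setOf_countable (hrun t₀)
    (Q := fun q' _ => moveOf (min q'.fed.length (Δ - 1) = k) (q.entry k) ∈ s) fun q' => .const _

theorem near_entry (hw : ∀ t ≠ t₀, Agree (w t)) (hw₀ : Near (w t₀))
    (noise : (Fin Δ → ℝ) × (Fin T → ℝ)) (a : ℕ → Fin d → ℝ) (k : ℕ) :
    Near ((gameRun s₀ K g w noise a T).entry k) ∧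
      (k ≠ (gameRun s₀ K g w noise a t₀).fed.length →
        Agree ((gameRun s₀ K g w noise a T).entry k)) := by
  have h := (run_agree_near (Exceeds s₀ K g .left (seqAnswer a) noise) hw hw₀ rfl T).1.1 k
  cases he : (gameRun s₀ K g w noise a T).fed[k]? with
  | none =>
    rw [Record.entry, he]
    exact ⟨Agree.near rfl, fun _ => rfl⟩
  | some e =>
    rw [Record.entry, he]
    exact h e he

theorem existsUnique_isChallenge_gameMove (hw : ∀ t ≠ t₀, Agree (w t)) (hw₀ : Near (w t₀))
    (hΔ : 0 < Δ) (noise : (Fin Δ → ℝ) × (Fin T → ℝ)) (a : ℕ → Fin d → ℝ) :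
    ∃! k : ℕ, k < Δ ∧ (gameMove s₀ K g w t₀ k noise fun i : Fin k => a i).IsChallenge := by
  have key (k : ℕ) (hk : k < Δ) :
      (gameMove s₀ K g w t₀ k noise fun i : Fin k => a i).IsChallenge ↔
        min (gameRun s₀ K g w noise a t₀).fed.length (Δ - 1) = k := by
    rw [gameMove, isChallenge_moveOf (near_entry hw hw₀ noise _ k).1]
    rcases run_exceeds_seqAnswer_congr (s₀ := s₀) (K := K) (g := g) w .left noise (k := k)
      (fun i hi => extend_of_lt a hi) t₀ with h | ⟨h1, h2, -⟩
    · rw [gameRun, h, gameRun]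
    -- If more than `k` intervals are closed before `t₀`, then both conditions say `k = Δ - 1`.
    · change k < (gameRun s₀ K g w noise (extend fun i : Fin k => a i) t₀).fed.length at h1
      change k < (gameRun s₀ K g w noise a t₀).fed.length at h2
      omega
  refine ⟨min (gameRun s₀ K g w noise a t₀).fed.length (Δ - 1), ?_, fun k hk => ?_⟩
  · have hlt : min (gameRun s₀ K g w noise a t₀).fed.length (Δ - 1) < Δ := by omega
    exact ⟨hlt, (key _ hlt).2 rfl⟩
  · exact ((key k hk.1).1 hk.2).symm

variable (s₀ K)

/-- The adversary that draws the noises of the meta mechanism and plays the insertions of the two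
streams. -/
abbrev metaAdversary {ε : ℝ} (hε : 0 < ε) (hg : Measurable g) (hw : ∀ t ≠ t₀, Agree (w t))
    (hw₀ : Near (w t₀)) (T : ℕ) (hΔ : 0 < Δ) : Adversary d Δ where
  Coins := (Fin Δ → ℝ) × (Fin T → ℝ)
  law := noiseLaw T Δ ε
  isProbabilityMeasure := isProbabilityMeasure_noiseLaw hε
  move := gameMove s₀ K g w t₀
  measurable_move := measurable_gameMove hg
  exactly_one_challenge := existsUnique_isChallenge_gameMove hw hw₀ hΔ

variable {s₀ K}

theorem play_snd {n : ℕ} (H : HistogramMechanism.{u} d) (Adv : Adversary d n) (side : Side)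
    (r : Adv.Coins) (ω : H.Ω) (t : ℕ) :
    (play H Adv side r ω t).2 = fun i : Fin t => H.out ω (play H Adv side r ω (i + 1)).1 := by
  induction t with
  | zero => exact funext fun i => i.elim0
  | succ t ih =>
    funext i
    induction i using Fin.lastCases with
    | last => simp [play]
    | cast i => simpa [play] using congrFun ih i

theorem play_fst {n : ℕ} (H : HistogramMechanism.{u} d) (Adv : Adversary d n) (side : Side)
    (r : Adv.Coins) (ω : H.Ω) (t : ℕ) :
    (play H Adv side r ω t).1 =
      (List.range t).map fun k => (Adv.move k r (play H Adv side r ω k).2).sent side := by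
  induction t with
  | zero => rfl
  | succ t ih =>
    rw [List.range_succ, List.map_append, ← ih]
    rfl

/-- The outputs of the meta mechanism, reconstructed from the noises and the answers of `H`. -/
def outputsOfView (s₀ : Fin d → ℝ) (K : Fin Δ → ℝ) (g : (Fin d → ℝ) → ℝ)
    (w : ℕ → Side → Fin d → ℕ)
    (v : ((Fin Δ → ℝ) × (Fin T → ℝ)) × (Fin Δ → Move d) × (Fin Δ → Fin d → ℝ)) :
    Fin T → StepOutput d :=
  outputs T w (Exceeds s₀ K g .left (seqAnswer (extend v.2.2)) v.1) (seqAnswer (extend v.2.2))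

theorem measurable_outputsOfView (hg : Measurable g) :
    Measurable (outputsOfView (T := T) s₀ K g w) := by
  have hans (l : List (Side → Fin d → ℕ)) : Measurable
      fun v : ((Fin Δ → ℝ) × (Fin T → ℝ)) × (Fin Δ → Move d) × (Fin Δ → Fin d → ℝ) =>
        seqAnswer (extend v.2.2) l :=
    (measurable_extend Δ (l.length - 1)).comp measurable_snd.snd
  exact measurable_outputs w (measurableSet_exceeds hg .left hans measurable_fst) hans

/-- In the game, the left stream decides when intervals are closed, on both sides; the side
determines whose counts are inserted into `H`. -/
theorem outputsOfView_view (hw : ∀ t ≠ t₀, Agree (w t)) (hw₀ : Near (w t₀))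
    (H : HistogramMechanism.{u} d) {Adv : Adversary d Δ} {r : Adv.Coins}
    {noise : (Fin Δ → ℝ) × (Fin T → ℝ)}
    (hmove : ∀ k a, Adv.move k r a = gameMove s₀ K g w t₀ k noise a) (side : Side) (ω : H.Ω) :
    outputsOfView s₀ K g w (noise, (view H Adv side (r, ω)).2) =
      outputs T w (Exceeds s₀ K g .left (mechAnswer H ω side) noise) (mechAnswer H ω side) := by
  set b : ℕ → Fin d → ℝ := fun i => H.out ω (play H Adv side r ω (i + 1)).1 with hb
  set a : ℕ → Fin d → ℝ := extend (play H Adv side r ω Δ).2 with ha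
  have hab (i : ℕ) (hi : i < Δ) : a i = b i := by
    rw [ha, play_snd]
    exact extend_of_lt b hi
  have hlen : (gameRun s₀ K g w noise a T).fed.length ≤ Δ :=
    length_run_le (fun _ _ h => h.1) T
  have hsent (k : ℕ) (hk : k < (gameRun s₀ K g w noise a T).fed.length) :
      (Adv.move k r (play H Adv side r ω k).2).sent side =
        (gameRun s₀ K g w noise a T).fed[k] side := by
    have hent : (gameRun s₀ K g w noise (extend (play H Adv side r ω k).2) T).entry k =
        (gameRun s₀ K g w noise a T).fed[k] := by
      rw [play_snd]
      have hagree (i : ℕ) (hi : i < k) : extend (fun i : Fin k => b i) i = a i := by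
        rw [extend_of_lt b hi, hab i (by omega)]
      rcases run_exceeds_seqAnswer_congr (s₀ := s₀) (K := K) (g := g) w .left noise hagree T with
        h | ⟨-, -, h⟩
      · rw [gameRun, h, Record.entry]
        change (gameRun s₀ K g w noise a T).fed[k]?.getD 0 = _
        rw [List.getElem?_eq_getElem hk, Option.getD_some]
      · have h' := congrArg (fun l => l[k]?) h
        simp only [List.getElem?_take_of_lt (Nat.lt_succ_self k)] at h'
        rw [gameRun, Record.entry, h']
        change (gameRun s₀ K g w noise a T).fed[k]?.getD 0 = _
        rw [List.getElem?_eq_getElem hk, Option.getD_some]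
    have hne := near_entry (s₀ := s₀) (K := K) (g := g) hw hw₀ noise
      (extend (play H Adv side r ω k).2) k
    rw [hmove, gameMove, sent_moveOf hne.1 (fun h => hne.2 (by omega)), hent]
  have hans (l : List (Side → Fin d → ℕ)) (hl : l <+: (gameRun s₀ K g w noise a T).fed)
      (hl0 : l ≠ []) : seqAnswer a l = mechAnswer H ω side l := by
    have hpos := List.length_pos_iff.2 hl0
    have hle := hl.length_le
    rw [seqAnswer, hab _ (by omega), mechAnswer, hb]
    simp only
    rw [Nat.sub_add_cancel hpos, play_fst]
    congr 1
    refine List.ext_getElem (by simp) fun k h1 h2 => ?_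
    have hk : k < l.length := by simpa using h1
    rw [List.getElem_map, List.getElem_map, List.getElem_range, hsent k (by omega),
      hl.getElem hk]
  refine outputs_congr (fun t ht => exceeds_congr noise t fun h0 => hans _ ?_ h0)
    fun t ht hd => hans _ ?_ ?_
  · exact run_prefix w _ ht.le
  · have h := run_prefix w (Exceeds s₀ K g .left (seqAnswer a) noise) (Nat.succ_le_of_lt ht)
    have h' : run w (Exceeds s₀ K g .left (seqAnswer a) noise) (t + 1) = _ := run_succ_of_pos hd
    rwa [Nat.succ_eq_add_one, h'] at h
  · exact List.append_ne_nil_of_right_ne_nil _ (List.cons_ne_nil _ _)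

end Game

/-! ### Shifting the noises of the interval in which the streams differ -/

section Shift

variable {d T Δ : ℕ}

/-- `κ` marks time step `u`. -/
def Marked (κ : Fin T → Bool) (u : ℕ) : Prop := ∃ h : u < T, κ ⟨u, h⟩ = true

open Classical in
/-- The index of the interval that contains the time step `t` if `κ` marks the closing times. -/
def intervalIndex (κ : Fin T → Bool) (t : ℕ) : ℕ := Nat.count (Marked κ) t

open Classical in
/-- In the interval that contains `t₀`, the threshold is raised by `1`, and the query at the closing
time of this interval is raised by `2`; here `κ` marks the closing times. -/
def noiseShift (Δ t₀ : ℕ) (κ : Fin T → Bool) : (Fin Δ → ℝ) × (Fin T → ℝ) :=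
  (fun j => if (j : ℕ) = intervalIndex κ t₀ then 1 else 0,
    fun t => if κ t = true ∧ intervalIndex κ t = intervalIndex κ t₀ then 2 else 0)

theorem sum_abs_ite_le {n : ℕ} {p : Fin n → Prop} [DecidablePred p] {c : ℝ} (hc : 0 ≤ c)
    (h : ∀ i j, p i → p j → i = j) : ∑ i, |if p i then c else 0| ≤ c := by
  have h1 : ∑ i, |if p i then c else 0| = ∑ i, if p i then c else 0 :=
    Finset.sum_congr rfl fun i _ => abs_of_nonneg (by split_ifs <;> simp [hc])
  rw [h1, ← Finset.sum_filter, Finset.sum_const, nsmul_eq_mul]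
  have h2 : (Finset.univ.filter p).card ≤ 1 :=
    Finset.card_le_one.2 fun i hi j hj => h i j (by simpa using hi) (by simpa using hj)
  exact mul_le_of_le_one_left hc (by exact_mod_cast h2)

theorem sum_abs_noiseShift_fst_le (t₀ : ℕ) (κ : Fin T → Bool) :
    ∑ j, |(noiseShift Δ t₀ κ).1 j| ≤ 1 :=
  sum_abs_ite_le zero_le_one fun _ _ hi hj => Fin.ext (hi.trans hj.symm)

theorem sum_abs_noiseShift_snd_le (t₀ : ℕ) (κ : Fin T → Bool) :
    ∑ t, |(noiseShift Δ t₀ κ).2 t| ≤ 2 := by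
  classical
  exact sum_abs_ite_le zero_le_two fun i j hi hj => Fin.ext
    (Nat.count_injective (p := Marked κ) ⟨i.2, hi.1⟩ ⟨j.2, hj.1⟩ (hi.2.trans hj.2.symm))

/-- The outputs of the run in which the left stream decides are produced for the shifted noises
also by the run in which the right stream decides. -/
theorem outputs_exceeds_noiseShift {s₀ : Fin d → ℝ} {K : Fin Δ → ℝ} {g : (Fin d → ℝ) → ℝ}
    (hg : ∀ y y' : Fin d → ℝ, ‖y - y'‖ ≤ 1 → |g y - g y'| ≤ 1) {w : ℕ → Side → Fin d → ℕ}
    {t₀ : ℕ} (ht₀ : t₀ < T) (hw : ∀ t ≠ t₀, Agree (w t)) (hw₀ : Near (w t₀))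
    (ans : List (Side → Fin d → ℕ) → Fin d → ℝ) (noise : (Fin Δ → ℝ) × (Fin T → ℝ))
    {κ : Fin T → Bool}
    (hκ : ∀ t, κ t = (outputs T w (Exceeds s₀ K g .left ans noise) ans t).isRight) :
    outputs T w (Exceeds s₀ K g .right ans (noise + noiseShift Δ t₀ κ)) ans =
      outputs T w (Exceeds s₀ K g .left ans noise) ans := by
  classical
  set dec := Exceeds s₀ K g .left ans noise with hdec
  have hmark (t : ℕ) (ht : t < T) : κ ⟨t, ht⟩ = true ↔ dec t (pending w dec t) := by
    rw [hκ, outputs]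
    by_cases h : dec t (pending w dec t) <;> simp [h]
  have hindex (t : ℕ) (ht : t ≤ T) : (run w dec t).fed.length = intervalIndex κ t :=
    length_run_eq_count w (p := Marked κ)
      (fun u hu => ⟨fun h => (hmark u hu).1 h.2, fun h => ⟨hu, (hmark u hu).2 h⟩⟩) ht
  refine (outputs_congr (fun t ht => ?_) fun _ _ _ => rfl).symm
  have hinv := (run_agree_near dec hw hw₀ rfl t).2
  set r := pending w dec t with hr
  have hlen : r.fed.length = intervalIndex κ t := hindex t ht.le
  by_cases hΔ : r.fed.length < Δ
  swap
  · exact ⟨fun h => absurd h.1 hΔ, fun h => absurd h.1 hΔ⟩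
  have hleft : dec t r ↔ K ⟨_, hΔ⟩ + noise.1 ⟨_, hΔ⟩ <
      g (estimate s₀ ans .left r) + noise.2 ⟨t, ht⟩ :=
    ⟨fun ⟨_, _, h⟩ => h, fun h => ⟨hΔ, ht, h⟩⟩
  have hright : Exceeds s₀ K g .right ans (noise + noiseShift Δ t₀ κ) t r ↔
      K ⟨_, hΔ⟩ + (noise.1 ⟨_, hΔ⟩ + (noiseShift Δ t₀ κ).1 ⟨_, hΔ⟩) <
        g (estimate s₀ ans .right r) + (noise.2 ⟨t, ht⟩ + (noiseShift Δ t₀ κ).2 ⟨t, ht⟩) :=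
    ⟨fun ⟨_, _, h⟩ => h, fun h => ⟨hΔ, ht, h⟩⟩
  have hs1 : (noiseShift Δ t₀ κ).1 ⟨_, hΔ⟩ =
      if intervalIndex κ t = intervalIndex κ t₀ then 1 else 0 := by
    simp only [noiseShift, hlen]
  have hs2 : (noiseShift Δ t₀ κ).2 ⟨t, ht⟩ =
      if κ ⟨t, ht⟩ = true ∧ intervalIndex κ t = intervalIndex κ t₀ then 2 else 0 := rfl
  rw [hright, hs1, hs2]
  by_cases hi : intervalIndex κ t = intervalIndex κ t₀
  · have hdist : ‖estimate s₀ ans .left r - estimate s₀ ans .right r‖ ≤ 1 := by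
      refine (pi_norm_le_iff_of_nonneg zero_le_one).2 fun i => ?_
      obtain ⟨h1, h2⟩ := hinv.1 i
      have h1' : (r.cur .left i : ℝ) ≤ r.cur .right i + 1 := by exact_mod_cast h1
      have h2' : (r.cur .right i : ℝ) ≤ r.cur .left i + 1 := by exact_mod_cast h2
      rw [Real.norm_eq_abs, abs_le]
      simp only [estimate, Pi.sub_apply, Pi.add_apply]
      constructor <;> linarith
    have hgd := abs_le.1 (hg _ _ hdist)
    -- At the closing time the query gains `2`, the threshold `1`, and the streams differ by at
    -- most `1`; at earlier times only the threshold is raised.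
    by_cases hd : dec t r
    · have h := hleft.1 hd
      rw [if_pos hi, if_pos ⟨(hmark t ht).2 hd, hi⟩]
      exact ⟨fun _ => by linarith, fun _ => hd⟩
    · have h := not_lt.1 fun h => hd (hleft.2 h)
      rw [if_pos hi, if_neg fun h => hd ((hmark t ht).1 h.1)]
      exact ⟨fun h => absurd h hd, fun h' => by linarith⟩
  · have hcur : r.cur .left = r.cur .right :=
      hinv.2 (by rw [hindex t ht.le, hindex t₀ ht₀.le]; exact hi)
    have hest : estimate s₀ ans .left r = estimate s₀ ans .right r := by
      simp only [estimate, hcur]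
    rw [hleft, hest, if_neg hi, if_neg fun h => hi h.2, add_zero, add_zero]

end Shift

/-! ### Privacy of the meta mechanism -/

theorem DPClose.refl {α Ω : Type*} [MeasurableSpace α] [MeasurableSpace Ω] (P : Measure Ω)
    (X : Ω → α) {ε : ℝ} (hε : 0 ≤ ε) (δ : ℝ) : DPClose P X X ε δ := fun S _ =>
  (le_mul_of_one_le_left zero_le
    (by rw [← ENNReal.ofReal_one]; exact ENNReal.ofReal_le_ofReal (Real.one_le_exp hε))).trans
    le_self_add

/-- In the hybrid run, the left stream decides when intervals are closed, but the counts of the right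
stream are inserted into `H`. An event is at most `e ^ (ε / 2)` times as likely for the outputs of
the hybrid run as for those of the meta mechanism on the right stream. The bound is proved for each
set of closing times separately and then summed, since the shift of the noises depends on this
set. -/
theorem measure_hybrid_le {d T Δ : ℕ} {ε : ℝ} (hε : 0 < ε) (H : HistogramMechanism.{u} d)
    {s₀ : Fin d → ℝ} {K : Fin Δ → ℝ} {g : (Fin d → ℝ) → ℝ} (hg_meas : Measurable g)
    (hg : ∀ y y' : Fin d → ℝ, ‖y - y'‖ ≤ 1 → |g y - g y'| ≤ 1) (y : BinStream d T)
    {w : ℕ → Side → Fin d → ℕ} (hy : ∀ (t : Fin T) i, w t .right i = (y t i : ℕ))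
    {t₀ : ℕ} (ht₀ : t₀ < T) (hw : ∀ t ≠ t₀, Agree (w t)) (hw₀ : Near (w t₀))
    {S : Set (Fin T → StepOutput d)} (hS : MeasurableSet S) :
    (noiseLaw T Δ ε).prod H.P {p | outputs T w
        (Exceeds s₀ K g .left (mechAnswer H p.2 .right) p.1) (mechAnswer H p.2 .right) ∈ S} ≤
      ENNReal.ofReal (Real.exp (ε / 2)) *
        (noiseLaw T Δ ε).prod H.P {p | metaMechanism H s₀ K g y (p.2, p.1) ∈ S} := by
  have hprob := isProbabilityMeasure_noiseLaw (T := T) (Δ := Δ) hε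
  set hyb : ((Fin Δ → ℝ) × (Fin T → ℝ)) × H.Ω → Fin T → StepOutput d := fun p => outputs T w
    (Exceeds s₀ K g .left (mechAnswer H p.2 .right) p.1) (mechAnswer H p.2 .right)
  set A : ((Fin Δ → ℝ) × (Fin T → ℝ)) × H.Ω → Fin T → StepOutput d :=
    fun p => metaMechanism H s₀ K g y (p.2, p.1)
  have hA : Measurable A := (measurable_metaMechanism H s₀ K hg_meas y).comp measurable_swap
  set bits : (Fin T → StepOutput d) → Fin T → Bool := fun o t => (o t).isRight
  have hbits : Measurable bits := by
    refine measurable_pi_iff.2 fun t => ?_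
    have h : Measurable fun o : StepOutput d => o.isRight :=
      measurable_fun_sum measurable_const measurable_const
    exact h.comp (measurable_pi_apply t)
  set S' : (Fin T → Bool) → Set (Fin T → StepOutput d) := fun κ => S ∩ bits ⁻¹' {κ}
  have hS' (κ) : MeasurableSet (S' κ) := hS.inter (hbits (measurableSet_singleton κ))
  have hpart (κ) : (noiseLaw T Δ ε).prod H.P (hyb ⁻¹' S' κ) ≤
      ENNReal.ofReal (Real.exp (ε / 2)) * (noiseLaw T Δ ε).prod H.P (A ⁻¹' S' κ) := by
    set v := noiseShift Δ t₀ κ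
    have hsub : hyb ⁻¹' S' κ ⊆ Prod.map (· + v) id ⁻¹' (A ⁻¹' S' κ) := by
      intro p hp
      have heq : A (p.1 + v, p.2) = hyb p :=
        (metaMechanism_eq_outputs H y hy p.2 (p.1 + v)).trans
          (outputs_exceeds_noiseShift hg ht₀ hw hw₀ (mechAnswer H p.2 .right) p.1
            fun t => (congrFun hp.2 t).symm)
      change A (p.1 + v, p.2) ∈ S' κ
      rwa [heq]
    have hshift : Measurable (Prod.map (· + v) id :
        ((Fin Δ → ℝ) × (Fin T → ℝ)) × H.Ω → ((Fin Δ → ℝ) × (Fin T → ℝ)) × H.Ω) :=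
      (measurable_add_const v).prodMap measurable_id
    calc (noiseLaw T Δ ε).prod H.P (hyb ⁻¹' S' κ)
        ≤ (noiseLaw T Δ ε).prod H.P (Prod.map (· + v) id ⁻¹' (A ⁻¹' S' κ)) := measure_mono hsub
      _ = (((noiseLaw T Δ ε).map (· + v)).prod (H.P.map id)) (A ⁻¹' S' κ) := by
        rw [Measure.map_prod_map _ _ (measurable_add_const v) measurable_id,
          Measure.map_apply hshift (hA (hS' κ))]
      _ ≤ ((ENNReal.ofReal (Real.exp (ε / 2)) • noiseLaw T Δ ε).prod H.P) (A ⁻¹' S' κ) := by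
        rw [Measure.map_id]
        have h := map_add_const_noiseLaw_le (T := T) (Δ := Δ) hε (sum_abs_noiseShift_fst_le t₀ κ)
          (sum_abs_noiseShift_snd_le (Δ := Δ) t₀ κ)
        exact Measure.prod_mono h le_rfl (A ⁻¹' S' κ)
      _ = _ := by rw [Measure.prod_smul_left, Measure.smul_apply, smul_eq_mul]
  calc (noiseLaw T Δ ε).prod H.P (hyb ⁻¹' S)
      ≤ (noiseLaw T Δ ε).prod H.P (⋃ κ ∈ (Finset.univ : Finset (Fin T → Bool)),
          hyb ⁻¹' S' κ) :=
        measure_mono fun p hp => by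
          simp only [Set.mem_iUnion]
          exact ⟨bits (hyb p), Finset.mem_univ _, hp, rfl⟩
    _ ≤ ∑ κ, (noiseLaw T Δ ε).prod H.P (hyb ⁻¹' S' κ) := measure_biUnion_finset_le _ _
    _ ≤ ∑ κ, ENNReal.ofReal (Real.exp (ε / 2)) * (noiseLaw T Δ ε).prod H.P (A ⁻¹' S' κ) :=
        Finset.sum_le_sum fun κ _ => hpart κ
    _ = ENNReal.ofReal (Real.exp (ε / 2)) *
          (noiseLaw T Δ ε).prod H.P (⋃ κ ∈ (Finset.univ : Finset (Fin T → Bool)),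
            A ⁻¹' S' κ) := by
        rw [← Finset.mul_sum, measure_biUnion_finset]
        · intro κ _ κ' _ hne
          refine Set.disjoint_left.2 fun p hp hp' => hne ?_
          exact (show bits (A p) = κ from hp.2).symm.trans hp'.2
        · exact fun κ _ => hA (hS' κ)
    _ ≤ _ := by
        gcongr
        exact Set.iUnion₂_subset fun κ _ p hp => hp.1

end ContinualDP

end
theorem mainTheorem4 {d T Δ : ℕ} (ε δ : ℝ) (hε : 0 < ε) (hδ : δ ∈ Set.Icc (0 : ℝ) 1)
    (H : ContinualDP.HistogramMechanism.{u} d)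
    (hH : ContinualDP.IsAdaptivelyDP H Δ (ε / 2) (δ / Real.exp (ε / 2)))
    (s₀ : Fin d → ℝ) (K : Fin Δ → ℝ) (g : (Fin d → ℝ) → ℝ) (hg_meas : Measurable g)
    (hg : ∀ y y' : Fin d → ℝ, ‖y - y'‖ ≤ 1 → |g y - g y'| ≤ 1) :
    ContinualDP.IsDP (T := T) (ContinualDP.metaCoinsLaw H T Δ ε)
      (ContinualDP.metaMechanism H s₀ K g) ε δ := by
  open ContinualDP in
  intro x y hxy
  by_cases hne : x = y
  · subst hne
    exact DPClose.refl _ _ hε.le δ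
  obtain ⟨t₀, ht₀⟩ := Function.ne_iff.1 hne
  let w (t : ℕ) (side : Side) (i : Fin d) : ℕ :=
    if h : t < T then match side with
      | .left => x ⟨t, h⟩ i
      | .right => y ⟨t, h⟩ i
    else 0
  have hx (t : Fin T) (i : Fin d) : w t .left i = (x t i : ℕ) := dif_pos t.2
  have hy (t : Fin T) (i : Fin d) : w t .right i = (y t i : ℕ) := dif_pos t.2
  rcases Nat.eq_zero_or_pos Δ with rfl | hΔ
  -- There are no adversaries for `Δ = 0`, but then no interval is ever closed.
  · have hout (z : BinStream d T) (side : Side) (hz : ∀ (t : Fin T) i, w t side i = (z t i : ℕ)) :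
        metaMechanism H s₀ K g z = fun _ _ => Sum.inl () := by
      funext p t
      rw [metaMechanism_eq_outputs H z hz p.1 p.2, outputs, if_neg fun h => absurd h.1 (by omega)]
    rw [hout x .left hx, hout y .right hy]
    exact DPClose.refl _ _ hε.le δ
  have hw (t : ℕ) (ht : t ≠ t₀) : Agree (w t) := by
    funext i
    by_cases h : t < T
    · have : x ⟨t, h⟩ = y ⟨t, h⟩ := by
        by_contra h'
        exact ht (congrArg Fin.val (hxy h' ht₀))
      simp [w, h, this]
    · simp [w, h]
  have hw₀ : Near (w t₀) := by
    intro i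
    rw [hx, hy]
    omega
  intro S hS
  have hprob := isProbabilityMeasure_noiseLaw (T := T) (Δ := Δ) hε
  have hswap (z : BinStream d T) : metaCoinsLaw H T Δ ε {p | metaMechanism H s₀ K g z p ∈ S} =
      (noiseLaw T Δ ε).prod H.P {p | metaMechanism H s₀ K g z (p.2, p.1) ∈ S} :=
    ((Measure.measurePreserving_swap (μ := noiseLaw T Δ ε) (ν := H.P)).measure_preimage
      (measurable_metaMechanism H s₀ K hg_meas z hS).nullMeasurableSet).symm
  have hgame := (hH (metaAdversary s₀ K hε hg_meas hw hw₀ T hΔ)).1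
    (outputsOfView s₀ K g w ⁻¹' S) (measurable_outputsOfView hg_meas hS)
  have hview (side : Side) : {p | view H (metaAdversary s₀ K hε hg_meas hw hw₀ T hΔ) side p ∈
      outputsOfView s₀ K g w ⁻¹' S} = {p | outputs T w
        (Exceeds s₀ K g .left (mechAnswer H p.2 side) p.1) (mechAnswer H p.2 side) ∈ S} := by
    ext ⟨noise, ω⟩
    have h := outputsOfView_view (s₀ := s₀) (K := K) (g := g) hw hw₀ H
      (Adv := metaAdversary s₀ K hε hg_meas hw hw₀ T hΔ) (r := noise) (noise := noise)
      (fun _ _ => rfl) side ω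
    exact Eq.to_iff (congrArg (· ∈ S) h)
  rw [hview, hview] at hgame
  have hleft : {p : ((Fin Δ → ℝ) × (Fin T → ℝ)) × H.Ω | outputs T w
      (Exceeds s₀ K g .left (mechAnswer H p.2 .left) p.1) (mechAnswer H p.2 .left) ∈ S} =
      {p | metaMechanism H s₀ K g x (p.2, p.1) ∈ S} := by
    ext p
    exact Eq.to_iff (congrArg (· ∈ S) (metaMechanism_eq_outputs H x hx p.2 p.1).symm)
  rw [hswap, hswap]
  change (noiseLaw T Δ ε).prod H.P _ ≤ _ * (noiseLaw T Δ ε).prod H.P _ + _ at hgame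
  rw [hleft] at hgame
  have hhyb := measure_hybrid_le hε H (s₀ := s₀) (K := K) hg_meas hg y hy t₀.2 hw hw₀ hS
  refine hgame.trans (add_le_add ?_ ?_)
  · refine (mul_le_mul_right hhyb _).trans ?_
    rw [← mul_assoc, ← ENNReal.ofReal_mul (Real.exp_nonneg _), ← Real.exp_add, add_halves]
  · exact ENNReal.ofReal_le_ofReal (div_le_self hδ.1 (Real.one_le_exp (by positivity)))
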